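/- Let $\Bbbk$ be an algebraically closed field of characteristic $p$, and let $H$ be a finite-dimensional semisimple Hopf algebra over $\Bbbk$ with comultiplication $\Delta(a)=a_{(1)}\otimes a_{(2)}$, counit $\varepsilon$ and antipode $S$. Assume that $p>\dim_{\Bbbk}(H)^{1/2}$ or $p=0$. Let $\Lambda$ be a left integral of $H$ (that is, $a\Lambda=\varepsilon(a)\Lambda$ for all $a\in H$) and $\lambda$ a right integral of the dual Hopf algebra $H^*$ (that is, $\lambda(a_{(1)})f(a_{(2)})=f(1)\lambda(a)$ for all $f\in H^*$, $a\in H$), normalized so that $\lambda(\Lambda)=1$. Put $\mathbf{u}=S(\Lambda_{(2)})\Lambda_{(1)}\in H$, and for $n\in\mathbb{Z}$ let $P_n:H\to H$ be the $n$-th Sweedler power map: $P_n(a)=a_{(1)}\cdots a_{(n)}$ for $n\ge 1$, $P_0(a)=\varepsilon(a)1$, and $P_n(a)=S(a_{(1)})\cdots S(a_{(-n)})$ for $n\le -1$. For a finite-dimensional $H$-module $V$ with character $\chi_V(h)=\operatorname{tr}(v\mapsto h\cdot v)$, the $n$-th Frobenius–Schur indicator is $\nu_n(V)=\chi_V(\mathbf{u}^{-1}P_n(\Lambda))$.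 Let $V_i$ be a simple $H$-module with character $\chi_i$, and let $e_i$ be the corresponding central primitive idempotent of $H$, i.e. the one acting as the identity on $V_i$. Then $\mathbf{u}$ is invertible, $\dim_{\Bbbk}(V_i)\neq 0$ in $\Bbbk$, and for every $n\in\mathbb{Z}$ $$\nu_n(V_i)=\frac{\chi_i(P_n(\Lambda))\,\lambda(e_i)}{\dim_{\Bbbk}(V_i)^2}.$$ -/

import Mathlib

open scoped TensorProduct

namespace HopfFS

noncomputable section

/-- `Λ` is a left integral of the Hopf algebra `H`: `a Λ = ε(a) Λ` for all `a ∈ H`. -/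
def IsLeftIntegral (k : Type*) {H : Type*} [Field k] [Ring H] [HopfAlgebra k H] (Λ : H) : Prop :=
  ∀ a : H, a * Λ = (Coalgebra.counit a : k) • Λ

/-- `lam` is a right integral of the dual algebra `H^*` (whose product is convolution):
`lam * f = f(1) lam` for all `f ∈ H^*`; evaluation at `1` is the counit of `H^*`. -/
def IsRightDualIntegral {k H : Type*} [Field k] [Ring H] [HopfAlgebra k H] (lam : H →ₗ[k] k) :
    Prop :=
  ∀ f : H →ₗ[k] k, WithConv.toConv lam * WithConv.toConv f = f 1 • WithConv.toConv lam

/-- The element `𝐮 = S(Λ₍₂₎) Λ₍₁₎`. -/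
def bfu (k : Type*) {H : Type*} [Field k] [Ring H] [HopfAlgebra k H] (Λ : H) : H :=
  LinearMap.mul' k H
    ((HopfAlgebra.antipode k).rTensor H
      (TensorProduct.comm k H H (Coalgebra.comul Λ)))

/-- The `n`-th Sweedler power map. For `n ≥ 0` it is the `n`-th convolution power of the identity,
`a ↦ a₍₁₎ ⋯ a₍ₙ₎` (for `n = 0` the convolution unit `a ↦ ε(a) 1`); for `n < 0` it is the
`(-n)`-th convolution power of the antipode, `a ↦ S(a₍₁₎) ⋯ S(a₍₋ₙ₎)`. -/
def sweedlerPower (k H : Type*) [Field k] [Ring H] [HopfAlgebra k H] : ℤ → (H →ₗ[k] H)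
  | Int.ofNat n => (WithConv.toConv (LinearMap.id : H →ₗ[k] H) ^ n).ofConv
  | Int.negSucc n => (WithConv.toConv (HopfAlgebra.antipode k : H →ₗ[k] H) ^ (n + 1)).ofConv

/-- The character of the `H`-module `V`: `χ_V(h)` is the trace of the action of `h` on `V`. -/
def character (k : Type*) {H : Type*} (V : Type*) [Field k] [Ring H] [HopfAlgebra k H]
    [AddCommGroup V] [Module k V] [Module H V] [IsScalarTower k H V] (h : H) : k :=
  LinearMap.trace k V (Algebra.lsmul k k V h)

/-- The `n`-th Frobenius-Schur indicator `ν_n(V) = χ_V(𝐮⁻¹ P_n(Λ))`, `n ∈ ℤ`, computed with the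
integral `Λ`. (`Ring.inverse` is the inverse of a unit.) -/
def indicator (k : Type*) {H : Type*} (V : Type*) [Field k] [Ring H] [HopfAlgebra k H]
    [AddCommGroup V] [Module k V] [Module H V] [IsScalarTower k H V] (Λ : H) (n : ℤ) : k :=
  character k V (Ring.inverse (bfu k Λ) * sweedlerPower k H n Λ)

/-- `e` is a central primitive idempotent of the ring `A`: a nonzero central idempotent such that
the only central idempotents below it are `0` and `e`. -/
structure IsCentralPrimitiveIdempotent {A : Type*} [Ring A] (e : A) : Prop where
  mem_center : e ∈ Subring.center A
  idem : IsIdempotentElem e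
  ne_zero : e ≠ 0
  primitive : ∀ f ∈ Subring.center A, IsIdempotentElem f → f * e = f → f = 0 ∨ f = e

end

end HopfFS

/-!
The formula is the comparison of two computations of the trace of a left multiplication operator
`L_a : H → H`, combined with the centrality of the elements `P_n(Λ)`.

For a left integral, `Λ₍₁₎ ⊗ x Λ₍₂₎ = S(x) Λ₍₁₎ ⊗ Λ₍₂₎`. Applying `λ` to the first factor gives
`x = λ(S(x) Λ₍₁₎) Λ₍₂₎`, so `S` is injective, hence bijective, and `Λ₍₁₎`, `S(Λ₍₂₎)` are dual bases
for the bilinear form `λ(x y)`. Therefore `tr f = λ(f(S(Λ₍₂₎)) Λ₍₁₎)` for every operator `f` on `H`,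
and in particular `tr L_a = λ(a 𝐮)` (`trace_mulLeft_eq_integral`).

By Burnside's theorem a simple module has dimension at most `(dim H)^{1/2}`, so this dimension is
nonzero in `k` (`finrank_cast_ne_zero`). If `x 𝐮 = 0` then the trace vanishes on all `L_{xb}`,
whereas `x H`, if nonzero, contains an idempotent whose left multiplication has as trace the
dimension of a simple right module; so `x = 0` and `𝐮` is a unit (`isUnit_of_trace_mulLeft`).

On the other hand the block `H e` is isomorphic to `End V`, so
`tr L_{ea} = dim(V) χ_V(a)` (`trace_mulLeft_mul_idempotent`). With `a = 𝐮⁻¹` the two computations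
give `λ(e) = dim(V) χ_V(𝐮⁻¹)`.

Finally `P_n(Λ)` is central (`commute_sweedlerPower`), which uses that a semisimple Hopf algebra is
unimodular, but neither that `𝐮` is central nor that `S² = id`. So `P_n(Λ)` acts on `V` by a scalar
`c`, whence `ν_n(V) = c χ_V(𝐮⁻¹)` and `χ_V(P_n(Λ)) = c dim(V)`.
-/

namespace HopfFS

open Coalgebra HopfAlgebra

section HopfAlgebra

variable {k H : Type*} [Field k] [Ring H] [HopfAlgebra k H]

/-! ### Moving a factor across the coproduct of an integral -/

lemma comul_eq_conv_includeLeft_includeRight :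
    WithConv.toConv (comul : H →ₗ[k] H ⊗[k] H) =
      WithConv.toConv (Algebra.TensorProduct.includeLeft : H →ₐ[k] H ⊗[k] H).toLinearMap *
      WithConv.toConv (Algebra.TensorProduct.includeRight : H →ₐ[k] H ⊗[k] H).toLinearMap := by
  ext x
  rw [(ℛ k x).convMul_apply]
  simp [(ℛ k x).eq]

/-- In Sweedler notation, `(S(x₍₁₎) ⊗ 1) Δ(x₍₂₎) = 1 ⊗ x`: the comultiplication is the convolution
of the two inclusions, and the first of these is cancelled by its composite with `S`. -/
lemma conv_includeLeft_antipode :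
    WithConv.toConv ((Algebra.TensorProduct.includeLeft : H →ₐ[k] H ⊗[k] H).toLinearMap ∘ₗ
        antipode k) * WithConv.toConv (comul : H →ₗ[k] H ⊗[k] H) =
      WithConv.toConv (Algebra.TensorProduct.includeRight : H →ₐ[k] H ⊗[k] H).toLinearMap := by
  set j₁ := (Algebra.TensorProduct.includeLeft : H →ₐ[k] H ⊗[k] H)
  have hS : WithConv.toConv (j₁.toLinearMap ∘ₗ antipode k) *
      WithConv.toConv j₁.toLinearMap = 1 := by
    have h := LinearMap.algHom_comp_convMul_distrib j₁
      (WithConv.toConv (antipode k (A := H))) (WithConv.toConv LinearMap.id)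
    rw [LinearMap.antipode_mul_id] at h
    apply WithConv.ofConv_injective
    refine Eq.trans h.symm ?_
    ext x
    simp [LinearMap.convOne_def]
  rw [comul_eq_conv_includeLeft_includeRight, ← mul_assoc, hS, one_mul]

/-- In Sweedler notation, `Δ(x₍₁₎) (1 ⊗ S(x₍₂₎)) = x ⊗ 1`. -/
lemma conv_includeRight_antipode :
    WithConv.toConv (comul : H →ₗ[k] H ⊗[k] H) *
        WithConv.toConv ((Algebra.TensorProduct.includeRight : H →ₐ[k] H ⊗[k] H).toLinearMap ∘ₗ
          antipode k) =
      WithConv.toConv (Algebra.TensorProduct.includeLeft : H →ₐ[k] H ⊗[k] H).toLinearMap := by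
  set j₂ := (Algebra.TensorProduct.includeRight : H →ₐ[k] H ⊗[k] H)
  have hS : WithConv.toConv j₂.toLinearMap *
      WithConv.toConv (j₂.toLinearMap ∘ₗ antipode k) = 1 := by
    have h := LinearMap.algHom_comp_convMul_distrib j₂
      (WithConv.toConv LinearMap.id) (WithConv.toConv (antipode k (A := H)))
    rw [LinearMap.id_mul_antipode] at h
    apply WithConv.ofConv_injective
    refine Eq.trans h.symm ?_
    ext x
    simp [LinearMap.convOne_def]
  rw [comul_eq_conv_includeLeft_includeRight, mul_assoc, hS, mul_one]

variable {Λ : H} {lam : H →ₗ[k] k} {M : Type*} [AddCommGroup M] [Module k M]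

lemma sum_smul_counit {x : H} {ι : Type*} (R : Repr k x ι) :
    ∑ i ∈ R.index, counit (R := k) (R.right i) • R.left i = x := by
  have h := congr(TensorProduct.rid k H $(sum_tmul_counit_eq (R := k) R))
  simpa only [map_sum, TensorProduct.rid_tmul, one_smul] using h

/-- For a left integral, `Λ₍₁₎ ⊗ x Λ₍₂₎ = S(x) Λ₍₁₎ ⊗ Λ₍₂₎`. -/
lemma one_tmul_mul_comul (hΛ : IsLeftIntegral k Λ) (x : H) :
    ((1 : H) ⊗ₜ[k] x) * comul (R := k) Λ = (antipode k x ⊗ₜ[k] 1) * comul (R := k) Λ := by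
  have h := congr($(conv_includeLeft_antipode (k := k) (H := H)) x)
  rw [(ℛ k x).convMul_apply] at h
  simp only [LinearMap.comp_apply, AlgHom.toLinearMap_apply,
    Algebra.TensorProduct.includeLeft_apply, Algebra.TensorProduct.includeRight_apply] at h
  rw [← h, Finset.sum_mul]
  simp only [mul_assoc, ← Bialgebra.comul_mul, hΛ _, map_smul, mul_smul_comm]
  simp only [← smul_mul_assoc, ← Finset.sum_mul, TensorProduct.smul_tmul',
    ← TensorProduct.sum_tmul, ← map_smul, ← map_sum, sum_smul_counit]

/-- For a right integral, `Λ₍₁₎ x ⊗ Λ₍₂₎ = Λ₍₁₎ ⊗ Λ₍₂₎ S(x)`. -/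
lemma comul_mul_tmul_one (hΛ : ∀ a : H, Λ * a = (counit a : k) • Λ) (x : H) :
    comul (R := k) Λ * (x ⊗ₜ[k] (1 : H)) = comul (R := k) Λ * (1 ⊗ₜ[k] antipode k x) := by
  have h := congr($(conv_includeRight_antipode (k := k) (H := H)) x)
  rw [(ℛ k x).convMul_apply] at h
  simp only [LinearMap.comp_apply, AlgHom.toLinearMap_apply,
    Algebra.TensorProduct.includeLeft_apply, Algebra.TensorProduct.includeRight_apply] at h
  rw [← h, Finset.mul_sum]
  simp only [← mul_assoc, ← Bialgebra.comul_mul, hΛ _, map_smul, smul_mul_assoc]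
  simp only [← mul_smul_comm, ← Finset.mul_sum, ← TensorProduct.tmul_smul,
    ← TensorProduct.tmul_sum, ← map_smul, ← map_sum, sum_counit_smul]

lemma sum_apply_mul_right (hΛ : IsLeftIntegral k Λ) {ι : Type*} (R : Repr k Λ ι)
    (B : H →ₗ[k] H →ₗ[k] M) (x : H) :
    ∑ i ∈ R.index, B (R.left i) (x * R.right i) =
      ∑ i ∈ R.index, B (antipode k x * R.left i) (R.right i) := by
  simpa [← R.eq, Finset.mul_sum] using congr(TensorProduct.lift B $(one_tmul_mul_comul hΛ x))

lemma sum_apply_mul_left (hΛ : ∀ a : H, Λ * a = (counit a : k) • Λ) {ι : Type*}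
    (R : Repr k Λ ι) (B : H →ₗ[k] H →ₗ[k] M) (x : H) :
    ∑ i ∈ R.index, B (R.left i * x) (R.right i) =
      ∑ i ∈ R.index, B (R.left i) (R.right i * antipode k x) := by
  simpa [← R.eq, Finset.sum_mul] using congr(TensorProduct.lift B $(comul_mul_tmul_one hΛ x))

/-! ### The Frobenius form `λ` and the trace of left multiplication -/

/-- The defining property of a right dual integral with the test functional removed:
`λ(x₍₁₎) x₍₂₎ = λ(x) 1`. -/
lemma sum_integral_smul (hlam : IsRightDualIntegral lam) (x : H) {ι : Type*} (R : Repr k x ι) :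
    ∑ i ∈ R.index, lam (R.left i) • R.right i = lam x • (1 : H) := by
  rw [← sub_eq_zero, ← Module.forall_dual_apply_eq_zero_iff k]
  intro f
  have h := congr($(hlam f) x)
  rw [R.convMul_apply] at h
  simpa [sub_eq_zero, mul_comm] using h

/-- Apply `λ` to the first factor of `Λ₍₁₎ ⊗ x Λ₍₂₎ = S(x) Λ₍₁₎ ⊗ Λ₍₂₎`. In particular the antipode
is injective. -/
lemma sum_integral_antipode_smul (hΛ : IsLeftIntegral k Λ) (hlam : IsRightDualIntegral lam)
    (hnorm : lam Λ = 1) {ι : Type*} (R : Repr k Λ ι) (x : H) :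
    ∑ i ∈ R.index, lam (antipode k x * R.left i) • R.right i = x := by
  have h := sum_apply_mul_right hΛ R (LinearMap.lsmul k H ∘ₗ lam) x
  simp only [LinearMap.comp_apply, LinearMap.lsmul_apply] at h
  rw [← h]
  simp only [← mul_smul_comm, ← Finset.mul_sum]
  rw [sum_integral_smul hlam, hnorm, one_smul, mul_one]

lemma antipode_bijective [FiniteDimensional k H] (hΛ : IsLeftIntegral k Λ)
    (hlam : IsRightDualIntegral lam) (hnorm : lam Λ = 1) :
    Function.Bijective (antipode k : H →ₗ[k] H) := by
  have hinj : Function.Injective (antipode k : H →ₗ[k] H) := by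
    rw [injective_iff_map_eq_zero]
    intro x hx
    rw [← sum_integral_antipode_smul hΛ hlam hnorm (ℛ k Λ) x]
    simp [hx]
  exact ⟨hinj, LinearMap.injective_iff_surjective.mp hinj⟩

/-- `Λ₍₁₎` and `S(Λ₍₂₎)` are dual bases for the form `(x, y) ↦ λ(x y)`. -/
lemma sum_integral_smul_antipode [FiniteDimensional k H] (hΛ : IsLeftIntegral k Λ)
    (hlam : IsRightDualIntegral lam) (hnorm : lam Λ = 1) {ι : Type*} (R : Repr k Λ ι) (y : H) :
    ∑ i ∈ R.index, lam (y * R.left i) • antipode k (R.right i) = y := by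
  obtain ⟨x, rfl⟩ := (antipode_bijective hΛ hlam hnorm).2 y
  conv_rhs => rw [← sum_integral_antipode_smul hΛ hlam hnorm R x]
  simp

/-- The trace formula `tr f = λ(f(S(Λ₍₂₎)) Λ₍₁₎)`. -/
lemma trace_eq_sum_integral [FiniteDimensional k H] (hΛ : IsLeftIntegral k Λ)
    (hlam : IsRightDualIntegral lam) (hnorm : lam Λ = 1) {ι : Type*} (R : Repr k Λ ι)
    (f : H →ₗ[k] H) :
    LinearMap.trace k H f = ∑ i ∈ R.index, lam (f (antipode k (R.right i)) * R.left i) := by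
  -- Expanding in the dual bases writes `f` as a sum of operators of rank at most one.
  have hf : f = ∑ i ∈ R.index, (lam ∘ₗ LinearMap.mulRight k (R.left i)).smulRight
      (f (antipode k (R.right i))) := by
    ext y
    conv_lhs => rw [← sum_integral_smul_antipode hΛ hlam hnorm R y]
    simp
  conv_lhs => rw [hf]
  simp [LinearMap.trace_smulRight]

lemma bfu_eq_sum {ι : Type*} (R : Repr k Λ ι) :
    bfu k Λ = ∑ i ∈ R.index, antipode k (R.right i) * R.left i := by
  simp [bfu, ← R.eq]

/-- The trace form of the regular representation is `λ` twisted by `𝐮`. -/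
lemma trace_mulLeft_eq_integral [FiniteDimensional k H] (hΛ : IsLeftIntegral k Λ)
    (hlam : IsRightDualIntegral lam) (hnorm : lam Λ = 1) (a : H) :
    LinearMap.trace k H (LinearMap.mulLeft k a) = lam (a * bfu k Λ) := by
  rw [trace_eq_sum_integral hΛ hlam hnorm (ℛ k Λ), bfu_eq_sum (ℛ k Λ)]
  simp [Finset.mul_sum, mul_assoc]

/-! ### Unimodularity of semisimple Hopf algebras -/

/-- Maschke's theorem: the component of `1` in a left ideal complementary to `ker ε` is a left
integral. -/
lemma exists_leftIntegral_counit_eq_one [IsSemisimpleRing H] :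
    ∃ t : H, IsLeftIntegral k t ∧ (counit t : k) = 1 := by
  let K : Ideal H := RingHom.ker (Bialgebra.counitAlgHom k H)
  have hK : ∀ x : H, x ∈ K ↔ (counit x : k) = 0 := fun x => Iff.rfl
  obtain ⟨J, hJ⟩ := exists_isCompl K
  obtain ⟨a, ha, t, ht, hat⟩ :=
    Submodule.mem_sup.mp (hJ.sup_eq_top ▸ Submodule.mem_top : (1 : H) ∈ K ⊔ J)
  refine ⟨t, fun x => ?_, ?_⟩
  -- `y * t` lies in both complementary ideals, since `t = 1 - a` with `a ∈ ker ε`.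
  · set y := x - (counit x : k) • (1 : H)
    have hy : y ∈ K := by simp [hK, y]
    have h1 : y * t ∈ J := J.mul_mem_left _ ht
    have h2 : y * t ∈ K := by
      rw [eq_sub_of_add_eq' hat, mul_sub, mul_one]
      exact K.sub_mem hy (K.mul_mem_left _ ha)
    have h3 : y * t = 0 := Submodule.disjoint_def.mp hJ.disjoint _ h2 h1
    rw [sub_mul, smul_mul_assoc, one_mul, sub_eq_zero] at h3
    exact h3
  · have h := congr(counit (R := k) $hat)
    rw [map_add, (hK a).mp ha, zero_add, Bialgebra.counit_one] at h
    exact h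

/-- Semisimple Hopf algebras are unimodular. -/
lemma isRightIntegral_of_isLeftIntegral [IsSemisimpleRing H]
    (hS : Function.Surjective (antipode k : H →ₗ[k] H)) (hΛ : IsLeftIntegral k Λ) (a : H) :
    Λ * a = (counit a : k) • Λ := by
  obtain ⟨t, ht, ht1⟩ := exists_leftIntegral_counit_eq_one (k := k) (H := H)
  have hr : ∀ a : H, antipode k t * a = (counit a : k) • antipode k t := by
    intro a
    obtain ⟨b, rfl⟩ := hS a
    rw [← antipode_mul_antidistrib, ht, map_smul, counit_antipode]
  -- Evaluate `S(t) t` by the integral property of either factor.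
  have hSt : antipode k t = t := by
    have h1 := hr t
    rw [ht, counit_antipode, ht1, one_smul, one_smul] at h1
    exact h1.symm
  -- Evaluate `t Λ` likewise, with `t` as a right integral.
  have hΛt : Λ = (counit Λ : k) • t := by
    rw [← hSt, ← hr, hSt, hΛ, ht1, one_smul]
  rw [hΛt, smul_mul_assoc, ← hSt, hr, smul_comm]

/-! ### Sweedler powers of an integral are central -/

lemma pow_comp_coalgHom {C D A : Type*} [AddCommGroup C] [Module k C] [Coalgebra k C]
    [AddCommGroup D] [Module k D] [Coalgebra k D] [Ring A] [Algebra k A]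
    (f : WithConv (D →ₗ[k] A)) (φ : C →ₗc[k] D) (n : ℕ) :
    (f ^ n).ofConv ∘ₗ φ.toLinearMap =
      (WithConv.toConv (f.ofConv ∘ₗ φ.toLinearMap) ^ n).ofConv := by
  induction n with
  | zero => ext x; simp [LinearMap.convOne_def]
  | succ n ih =>
    rw [pow_succ, pow_succ, LinearMap.convMul_comp_coalgHom_distrib, ih]

/-- The map `b ⊗ x ↦ ε(x) f(b)`, as an element of the convolution algebra `Hom(H ⊗ H, H)`. -/
noncomputable def convFst (f : H →ₗ[k] H) : WithConv (H ⊗[k] H →ₗ[k] H) :=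
  WithConv.toConv (f ∘ₗ (TensorProduct.rid k H).toLinearMap ∘ₗ
    (counit (R := k) (A := H)).lTensor H)

/-- The map `b ⊗ x ↦ ε(b) f(x)`, as an element of the convolution algebra `Hom(H ⊗ H, H)`. -/
noncomputable def convSnd (f : H →ₗ[k] H) : WithConv (H ⊗[k] H →ₗ[k] H) :=
  WithConv.toConv (f ∘ₗ (TensorProduct.lid k H).toLinearMap ∘ₗ
    (counit (R := k) (A := H)).rTensor H)

/-- If `f ∘ φ` and `f ∘ ψ` are the two convolution products of `convFst f` and `convSnd f`, then
`f(x₍₁₎) f^{*n}(φ(b ⊗ x₍₂₎)) = f^{*n}(ψ(b ⊗ x₍₁₎)) f(x₍₂₎)`. This is the associativity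
`q (p q)ⁿ = (q p)ⁿ q` in the convolution algebra `Hom(H ⊗ H, H)`. -/
lemma sum_mul_convPow_eq (f : H →ₗ[k] H) (φ ψ : H ⊗[k] H →ₗc[k] H)
    (hφ : WithConv.toConv (f ∘ₗ φ.toLinearMap) = convFst f * convSnd f)
    (hψ : WithConv.toConv (f ∘ₗ ψ.toLinearMap) = convSnd f * convFst f)
    (n : ℕ) (b x : H) {ι : Type*} (R : Repr k x ι) :
    ∑ i ∈ R.index, f (R.left i) * (WithConv.toConv f ^ n) (φ (b ⊗ₜ R.right i)) =
      ∑ i ∈ R.index, (WithConv.toConv f ^ n) (ψ (b ⊗ₜ R.left i)) * f (R.right i) := by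
  have key : convSnd f * (convFst f * convSnd f) ^ n = (convSnd f * convFst f) ^ n * convSnd f := by
    have : SemiconjBy (convSnd f) (convFst f * convSnd f) (convSnd f * convFst f) :=
      (mul_assoc _ _ _).symm
    exact this.pow_right n
  have eφ : (convFst f * convSnd f) ^ n =
      WithConv.toConv ((WithConv.toConv f ^ n).ofConv ∘ₗ φ.toLinearMap) := by
    rw [← hφ, pow_comp_coalgHom]
  have eψ : (convSnd f * convFst f) ^ n =
      WithConv.toConv ((WithConv.toConv f ^ n).ofConv ∘ₗ ψ.toLinearMap) := by
    rw [← hψ, pow_comp_coalgHom]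
  rw [eφ, eψ] at key
  have h := congr($key (b ⊗ₜ[k] x))
  rw [((ℛ k b).tmul R).convMul_apply, ((ℛ k b).tmul R).convMul_apply] at h
  simp only [Coalgebra.Repr.tmul_index, Coalgebra.Repr.tmul_left, Coalgebra.Repr.tmul_right,
    Finset.sum_product_right] at h
  have hl : ∀ i, ∑ j ∈ (ℛ k b).index, (counit ((ℛ k b).left j) : k) •
      (ℛ k b).right j ⊗ₜ[k] R.right i = b ⊗ₜ R.right i := fun i => by
    simp only [TensorProduct.smul_tmul', ← TensorProduct.sum_tmul, sum_counit_smul]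
  have hr : ∀ i, ∑ j ∈ (ℛ k b).index, (counit ((ℛ k b).right j) : k) •
      (ℛ k b).left j ⊗ₜ[k] R.left i = b ⊗ₜ R.left i := fun i => by
    simp only [TensorProduct.smul_tmul', ← TensorProduct.sum_tmul, sum_smul_counit]
  calc _ = _ := ?_
    _ = _ := h
    _ = _ := ?_
  · refine Finset.sum_congr rfl fun i _ => ?_
    rw [← hl i]
    simp [convSnd, Finset.mul_sum]
  · refine Finset.sum_congr rfl fun i _ => ?_
    rw [← hr i]
    simp [convSnd, Finset.sum_mul]

lemma conv_fst_snd_apply (f : H →ₗ[k] H) (b x : H) :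
    (convFst f * convSnd f) (b ⊗ₜ x) = f b * f x := by
  rw [((ℛ k b).tmul (ℛ k x)).convMul_apply]
  conv_rhs => rw [← sum_smul_counit (k := k) (ℛ k b), ← sum_counit_smul (R := k) (ℛ k x)]
  simp only [map_sum, Finset.sum_mul_sum, Coalgebra.Repr.tmul_index, Finset.sum_product]
  refine Finset.sum_congr rfl fun i _ => Finset.sum_congr rfl fun j _ => ?_
  simp [convFst, convSnd, smul_smul, mul_comm]

lemma conv_snd_fst_apply (f : H →ₗ[k] H) (b x : H) :
    (convSnd f * convFst f) (b ⊗ₜ x) = f x * f b := by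
  rw [((ℛ k b).tmul (ℛ k x)).convMul_apply]
  conv_rhs => rw [← sum_counit_smul (R := k) (ℛ k b), ← sum_smul_counit (k := k) (ℛ k x)]
  simp only [map_sum, Finset.sum_mul_sum, Coalgebra.Repr.tmul_index, Finset.sum_product_right]
  refine Finset.sum_congr rfl fun i _ => Finset.sum_congr rfl fun j _ => ?_
  simp [convFst, convSnd, smul_smul, mul_comm]

/-- For multiplicative `f`: `f(x₍₁₎) f^{*n}(b x₍₂₎) = f^{*n}(x₍₁₎ b) f(x₍₂₎)`. -/
lemma sum_mul_convPow_of_mul (f : H →ₗ[k] H) (hf : ∀ x y, f (x * y) = f x * f y)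
    (n : ℕ) (b x : H) {ι : Type*} (R : Repr k x ι) :
    ∑ i ∈ R.index, f (R.left i) * (WithConv.toConv f ^ n) (b * R.right i) =
      ∑ i ∈ R.index, (WithConv.toConv f ^ n) (R.left i * b) * f (R.right i) := by
  refine sum_mul_convPow_eq f (Bialgebra.mulCoalgHom k H)
    ((Bialgebra.mulCoalgHom k H).comp (Bialgebra.TensorProduct.comm k H H : _ →ₗc[k] _))
    ?_ ?_ n b x R
  · ext b x
    refine Eq.trans ?_ (conv_fst_snd_apply f b x).symm
    exact hf b x
  · ext b x
    refine Eq.trans ?_ (conv_snd_fst_apply f b x).symm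
    exact hf x b

/-- For antimultiplicative `f`: `f(x₍₁₎) f^{*n}(x₍₂₎ b) = f^{*n}(b x₍₁₎) f(x₍₂₎)`. -/
lemma sum_mul_convPow_of_antimul (f : H →ₗ[k] H) (hf : ∀ x y, f (x * y) = f y * f x)
    (n : ℕ) (b x : H) {ι : Type*} (R : Repr k x ι) :
    ∑ i ∈ R.index, f (R.left i) * (WithConv.toConv f ^ n) (R.right i * b) =
      ∑ i ∈ R.index, (WithConv.toConv f ^ n) (b * R.left i) * f (R.right i) := by
  refine sum_mul_convPow_eq f
    ((Bialgebra.mulCoalgHom k H).comp (Bialgebra.TensorProduct.comm k H H : _ →ₗc[k] _))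
    (Bialgebra.mulCoalgHom k H) ?_ ?_ n b x R
  · ext b x
    refine Eq.trans ?_ (conv_fst_snd_apply f b x).symm
    exact hf x b
  · ext b x
    refine Eq.trans ?_ (conv_snd_fst_apply f b x).symm
    exact hf b x

/-- The Sweedler powers of a two-sided integral are central. For `n > 0`, write `a = S(b)`; then
`a Λ₍₁₎ ⋯ Λ₍ₙ₎ = Λ₍₁₎ b₍₁₎ Λ₍₂₎ ⋯ b₍ₙ₋₁₎ Λ₍ₙ₎ = Λ₍₁₎ ⋯ Λ₍ₙ₎ a`, by moving `b` across the coproduct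
of `Λ` from either end. The argument for `n < 0` is the same, with `f = S` antimultiplicative. -/
lemma commute_sweedlerPower (hΛ : IsLeftIntegral k Λ)
    (hΛ' : ∀ a : H, Λ * a = (counit a : k) • Λ)
    (hS : Function.Surjective (antipode k : H →ₗ[k] H)) (n : ℤ) (a : H) :
    Commute a (sweedlerPower k H n Λ) := by
  obtain ⟨b, rfl⟩ := hS a
  have hl := fun B : H →ₗ[k] H →ₗ[k] H => sum_apply_mul_right hΛ (ℛ k Λ) B b
  have hr := fun B : H →ₗ[k] H →ₗ[k] H => sum_apply_mul_left hΛ' (ℛ k Λ) B b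
  match n with
  | Int.ofNat 0 =>
    have : sweedlerPower k H (Int.ofNat 0) Λ = algebraMap k H (counit Λ) := rfl
    rw [this]
    exact Algebra.commute_algebraMap_right _ _
  | Int.ofNat (n + 1) =>
    set P := WithConv.toConv (LinearMap.id : H →ₗ[k] H) ^ n with hP
    have e₁ : sweedlerPower k H (Int.ofNat (n + 1)) Λ =
        ∑ i ∈ (ℛ k Λ).index, (ℛ k Λ).left i * P ((ℛ k Λ).right i) := by
      change (WithConv.toConv (LinearMap.id : H →ₗ[k] H) ^ (n + 1)) Λ = _
      rw [pow_succ', (ℛ k Λ).convMul_apply]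
      rfl
    have e₂ : sweedlerPower k H (Int.ofNat (n + 1)) Λ =
        ∑ i ∈ (ℛ k Λ).index, P ((ℛ k Λ).left i) * (ℛ k Λ).right i := by
      change (WithConv.toConv (LinearMap.id : H →ₗ[k] H) ^ (n + 1)) Λ = _
      rw [pow_succ, (ℛ k Λ).convMul_apply]
      rfl
    calc antipode k b * sweedlerPower k H (Int.ofNat (n + 1)) Λ
        = ∑ i ∈ (ℛ k Λ).index, (antipode k b * (ℛ k Λ).left i) * P ((ℛ k Λ).right i) := by
          rw [e₁, Finset.mul_sum]; simp only [mul_assoc]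
      _ = ∑ i ∈ (ℛ k Λ).index, (ℛ k Λ).left i * P (b * (ℛ k Λ).right i) :=
          (hl ((LinearMap.mul k H).compl₂ P.ofConv)).symm
      _ = ∑ i ∈ (ℛ k Λ).index, P ((ℛ k Λ).left i * b) * (ℛ k Λ).right i :=
          sum_mul_convPow_of_mul LinearMap.id (fun _ _ => rfl) n b Λ (ℛ k Λ)
      _ = ∑ i ∈ (ℛ k Λ).index, P ((ℛ k Λ).left i) * ((ℛ k Λ).right i * antipode k b) :=
          hr ((LinearMap.mul k H) ∘ₗ P.ofConv)
      _ = sweedlerPower k H (Int.ofNat (n + 1)) Λ * antipode k b := by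
          rw [e₂, Finset.sum_mul]; simp only [mul_assoc]
  | Int.negSucc n =>
    set P := WithConv.toConv (antipode k : H →ₗ[k] H) ^ n with hP
    have e₁ : sweedlerPower k H (Int.negSucc n) Λ =
        ∑ i ∈ (ℛ k Λ).index, antipode k ((ℛ k Λ).left i) * P ((ℛ k Λ).right i) := by
      change (WithConv.toConv (antipode k : H →ₗ[k] H) ^ (n + 1)) Λ = _
      rw [pow_succ', (ℛ k Λ).convMul_apply]
    have e₂ : sweedlerPower k H (Int.negSucc n) Λ =
        ∑ i ∈ (ℛ k Λ).index, P ((ℛ k Λ).left i) * antipode k ((ℛ k Λ).right i) := by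
      change (WithConv.toConv (antipode k : H →ₗ[k] H) ^ (n + 1)) Λ = _
      rw [pow_succ, (ℛ k Λ).convMul_apply]
    calc antipode k b * sweedlerPower k H (Int.negSucc n) Λ
        = ∑ i ∈ (ℛ k Λ).index, antipode k ((ℛ k Λ).left i * b) * P ((ℛ k Λ).right i) := by
          rw [e₁, Finset.mul_sum]; simp only [mul_assoc, antipode_mul_antidistrib]
      _ = ∑ i ∈ (ℛ k Λ).index, antipode k ((ℛ k Λ).left i) *
            P ((ℛ k Λ).right i * antipode k b) :=
          hr ((LinearMap.mul k H).compl₁₂ (antipode k) P.ofConv)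
      _ = ∑ i ∈ (ℛ k Λ).index, P (antipode k b * (ℛ k Λ).left i) *
            antipode k ((ℛ k Λ).right i) :=
          sum_mul_convPow_of_antimul (antipode k) antipode_mul_antidistrib n _ Λ (ℛ k Λ)
      _ = ∑ i ∈ (ℛ k Λ).index, P ((ℛ k Λ).left i) * antipode k (b * (ℛ k Λ).right i) :=
          (hl ((LinearMap.mul k H).compl₁₂ P.ofConv (antipode k))).symm
      _ = sweedlerPower k H (Int.negSucc n) Λ * antipode k b := by
          rw [e₂, Finset.sum_mul]; simp only [mul_assoc, antipode_mul_antidistrib]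

end HopfAlgebra

section SemisimpleAlgebra

/-! ### Semisimple algebras over an algebraically closed field -/

/-- A two-sided ideal of a semisimple ring is generated by a central idempotent. -/
lemma exists_central_idempotent_of_isTwoSided {A : Type*} [Ring A] [IsSemisimpleRing A]
    (I : Ideal A) [I.IsTwoSided] :
    ∃ f ∈ Subring.center A, IsIdempotentElem f ∧ f ∈ I ∧ ∀ x ∈ I, x * f = x := by
  obtain ⟨f, hf, hI⟩ := IsSemisimpleRing.ideal_eq_span_idempotent I
  have hfI : f ∈ I := hI ▸ Submodule.mem_span_singleton_self f
  have hr : ∀ x ∈ I, x * f = x := by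
    intro x hx
    rw [hI, Ideal.mem_span_singleton'] at hx
    obtain ⟨a, rfl⟩ := hx
    rw [mul_assoc, hf.eq]
  -- Semisimple rings are semiprime.
  have hann : ∀ y : A, (∀ a, y * a * y = 0) → y = 0 := by
    intro y hy
    obtain ⟨g, hg, hg'⟩ := IsSemisimpleRing.ideal_eq_span_idempotent (Ideal.span {y})
    have h1 : g ∈ Ideal.span {y} := hg' ▸ Submodule.mem_span_singleton_self g
    have h2 : y ∈ Ideal.span {g} := hg' ▸ Submodule.mem_span_singleton_self y
    obtain ⟨a, ha⟩ := Ideal.mem_span_singleton'.mp h1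
    obtain ⟨b, hb⟩ := Ideal.mem_span_singleton'.mp h2
    have : g = 0 := by
      rw [← hg.eq, ← ha, ← mul_assoc, mul_assoc a, mul_assoc a, hy, mul_zero]
    rw [← hb, this, mul_zero]
  refine ⟨f, Subring.mem_center_iff.mpr fun x => ?_, hf, hfI, hr⟩
  have h1 : f * x * f = f * x := hr _ (I.mul_mem_right x hfI)
  have h2 : x * f - f * x * f = 0 := by
    refine hann _ fun a => ?_
    have e : x * f - f * x * f = (1 - f) * (x * f) := by noncomm_ring
    have h3 : (1 - f) * (x * f) ∈ I := I.mul_mem_left _ (I.mul_mem_left _ hfI)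
    have h4 : (1 - f) * (x * f) * a ∈ I := I.mul_mem_right _ h3
    rw [e, ← hr _ h4, mul_assoc _ f, ← mul_assoc f, mul_sub, mul_one, hf.eq, sub_self, zero_mul,
      mul_zero]
  rw [sub_eq_zero] at h2
  rw [h2, h1]

variable {k A V : Type*} [Field k] [Ring A] [Algebra k A] [FiniteDimensional k A]
  [AddCommGroup V] [Module k V] [Module A V] [IsScalarTower k A V] [IsSimpleModule A V]

variable (k A V) in
/-- Burnside's theorem. -/
lemma lsmul_surjective [IsAlgClosed k] :
    Function.Surjective (Algebra.lsmul k k V : A →ₐ[k] Module.End k V) := by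
  have : FiniteDimensional k V := Module.Finite.trans A V
  have hk := IsSimpleModule.algebraMap_end_bijective_of_isAlgClosed (A := A) (V := V) k
  have : Module.Finite (Module.End A V) V := Module.Finite.of_restrictScalars_finite k _ _
  intro f
  let F : Module.End (Module.End A V) V :=
    { toFun := f
      map_add' := map_add f
      map_smul' := by
        intro c v
        obtain ⟨c, rfl⟩ := hk.2 c
        simp }
  obtain ⟨a, ha⟩ := Module.Finite.toModuleEnd_moduleEnd_surjective (R := A) (M := V) F
  exact ⟨a, LinearMap.ext fun v => congr($ha v)⟩

variable (k A V) in
lemma finrank_sq_le [IsAlgClosed k] : Module.finrank k V ^ 2 ≤ Module.finrank k A := by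
  have : FiniteDimensional k V := Module.Finite.trans A V
  have h := LinearMap.finrank_le_finrank_of_surjective
    (f := (Algebra.lsmul k k V : A →ₐ[k] Module.End k V).toLinearMap) (lsmul_surjective k A V)
  rwa [Module.finrank_linearMap, ← sq] at h

variable (A V) in
lemma finrank_cast_ne_zero [IsAlgClosed k] (p : ℕ) [CharP k p]
    (hp : p = 0 ∨ Module.finrank k A < p ^ 2) : (Module.finrank k V : k) ≠ 0 := by
  have : FiniteDimensional k V := Module.Finite.trans A V
  have : Nontrivial V := IsSimpleModule.nontrivial A V
  have hpos : 0 < Module.finrank k V := Module.finrank_pos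
  rw [Ne, CharP.cast_eq_zero_iff k p]
  intro h
  rcases hp with rfl | hp
  · rw [zero_dvd_iff] at h
    omega
  · have h1 := Nat.le_of_dvd hpos h
    have h2 := finrank_sq_le k A V
    have h3 := Nat.pow_le_pow_left h1 2
    omega

lemma trace_mulLeft_end {k V : Type*} [Field k] [AddCommGroup V] [Module k V]
    [FiniteDimensional k V] (f : Module.End k V) :
    LinearMap.trace k (Module.End k V) (LinearMap.mulLeft k f) =
      Module.finrank k V * LinearMap.trace k V f := by
  have h : (dualTensorHomEquiv k V V).conj (TensorProduct.map LinearMap.id f) =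
      LinearMap.mulLeft k f := by
    rw [LinearEquiv.conj_apply, LinearEquiv.comp_toLinearMap_symm_eq]
    ext φ v w
    simp
  have h' := LinearMap.trace_conj' (M := Module.Dual k V ⊗[k] V) (N := V →ₗ[k] V)
    (TensorProduct.map (LinearMap.id : Module.Dual k V →ₗ[k] _) f)
    (dualTensorHomEquiv k V V)
  rw [h] at h'
  rw [h', LinearMap.trace_tensorProduct', LinearMap.trace_id,
    Subspace.dual_finrank_eq]

/-- The representation on `V` is faithful on the block `A e`. -/
lemma smul_eq_zero_imp_mul_eq_zero [IsSemisimpleRing A] {e : A}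
    (he : IsCentralPrimitiveIdempotent e) (heV : ∀ v : V, e • v = v) {x : A}
    (hx : ∀ v : V, x • v = 0) : x * e = 0 := by
  obtain ⟨f, hfc, hfi, hf, hI⟩ :=
    exists_central_idempotent_of_isTwoSided (RingHom.ker (Module.toAddMonoidEnd A V))
  have hker : ∀ y, y ∈ RingHom.ker (Module.toAddMonoidEnd A V) ↔ ∀ v : V, y • v = 0 := fun y => by
    exact RingHom.mem_ker.trans DFunLike.ext_iff
  have hfe : Commute f e := (Subring.mem_center_iff.mp hfc e).symm
  -- Otherwise `f * e = e` by primitivity, so `e` would annihilate `V`.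
  have key : f * e = 0 := by
    refine (he.primitive (f * e) (mul_mem hfc he.mem_center) (hfi.mul_of_commute hfe he.idem)
      (by rw [mul_assoc, he.idem.eq])).resolve_right fun h => ?_
    obtain ⟨v, hv⟩ := @exists_ne V (IsSimpleModule.nontrivial A V) 0
    apply hv
    rw [← heV v, ← h, mul_smul, (hker f).mp hf]
  rw [← hI x ((hker x).mpr hx), mul_assoc, key, mul_zero]

/-- The block `A e` is isomorphic to `End V` as a left module, that is to `dim V` copies of `V`. -/
lemma trace_mulLeft_mul_idempotent [IsAlgClosed k] [IsSemisimpleRing A] {e : A}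
    (he : IsCentralPrimitiveIdempotent e) (heV : ∀ v : V, e • v = v) (a : A) :
    LinearMap.trace k A (LinearMap.mulLeft k (e * a)) =
      Module.finrank k V * LinearMap.trace k V (Algebra.lsmul k k V a) := by
  have : FiniteDimensional k V := Module.Finite.trans A V
  let ρ : A →ₐ[k] Module.End k V := Algebra.lsmul k k V
  obtain ⟨σ, hσ⟩ := ρ.toLinearMap.exists_rightInverse_of_surjective
    (LinearMap.range_eq_top.mpr (lsmul_surjective k A V))
  have hσ' : ∀ f, ρ (σ f) = f := fun f => congr($hσ f)
  have hρe : ρ e = 1 := LinearMap.ext heV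
  have hec := fun x => Subring.mem_center_iff.mp he.mem_center x
  -- `L_{ea}` factors through `ρ`, with a section of `ρ` cut down to the block.
  have h : LinearMap.mulLeft k (e * a) =
      (LinearMap.mulLeft k e ∘ₗ σ) ∘ₗ (LinearMap.mulLeft k (ρ a) ∘ₗ ρ.toLinearMap) := by
    ext x
    have : (a * x - σ (ρ a * ρ x)) * e = 0 := by
      refine smul_eq_zero_imp_mul_eq_zero (V := V) he heV fun v => ?_
      change ρ (a * x - σ (ρ a * ρ x)) v = 0
      rw [map_sub, hσ', map_mul, sub_self, LinearMap.zero_apply]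
    rw [sub_mul, sub_eq_zero, hec, hec] at this
    simpa [mul_assoc] using this
  rw [h, LinearMap.trace_comp_comm', ← trace_mulLeft_end]
  congr 1
  ext f : 1
  simp only [LinearMap.comp_apply, AlgHom.toLinearMap_apply, LinearMap.mulLeft_apply, map_mul,
    hρe, hσ', one_mul]
  rfl

/-- A nonzero left ideal contains a simple one, `A g` with `g` idempotent; right multiplication by
`g` projects onto it, so its trace is the dimension of a simple module. -/
lemma exists_mem_trace_mulRight_ne_zero {k A : Type*} [Field k] [Ring A] [Algebra k A]
    [FiniteDimensional k A] [IsAlgClosed k] [IsSemisimpleRing A] (p : ℕ) [CharP k p]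
    (hp : p = 0 ∨ Module.finrank k A < p ^ 2) {I : Ideal A} (hI : I ≠ ⊥) :
    ∃ g ∈ I, LinearMap.trace k A (LinearMap.mulRight k g) ≠ 0 := by
  have : Nontrivial I := Submodule.nontrivial_iff_ne_bot.mpr hI
  obtain ⟨m, hm⟩ := IsSemisimpleModule.exists_simple_submodule A I
  set W : Ideal A := m.map I.subtype
  have : IsSimpleModule A W := IsSimpleModule.congr (Submodule.equivSubtypeMap _ m).symm
  obtain ⟨g, hg, hW⟩ := IsSemisimpleRing.ideal_eq_span_idempotent W
  have hgW : g ∈ W := hW ▸ Submodule.mem_span_singleton_self g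
  refine ⟨g, Submodule.map_subtype_le _ m hgW, ?_⟩
  have hproj : LinearMap.IsProj (W.restrictScalars k) (LinearMap.mulRight k g) := by
    refine ⟨fun x => W.mul_mem_left x hgW, fun x hx => ?_⟩
    rw [Submodule.restrictScalars_mem, hW] at hx
    obtain ⟨a, rfl⟩ := Ideal.mem_span_singleton'.mp hx
    rw [LinearMap.mulRight_apply, mul_assoc, hg.eq]
  rw [hproj.trace]
  have : IsSimpleModule A (W.restrictScalars k) := ‹IsSimpleModule A W›
  exact finrank_cast_ne_zero A (W.restrictScalars k) p hp

/-- If the trace form is represented as `λ(· u)`, then `u` is a unit: the dimensions of the simple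
modules being nonzero in `k`, no nonzero `x` satisfies `x u = 0`. -/
lemma isUnit_of_trace_mulLeft {k A : Type*} [Field k] [Ring A] [Algebra k A]
    [FiniteDimensional k A] [IsAlgClosed k] [IsSemisimpleRing A] (p : ℕ) [CharP k p]
    (hp : p = 0 ∨ Module.finrank k A < p ^ 2) (lam : A →ₗ[k] k) (u : A)
    (hu : ∀ a, LinearMap.trace k A (LinearMap.mulLeft k a) = lam (a * u)) : IsUnit u := by
  have hinj : Function.Injective (LinearMap.mulRight k u) := by
    rw [injective_iff_map_eq_zero]
    intro x hx
    rw [LinearMap.mulRight_apply] at hx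
    by_contra hx0
    -- `tr L_{xb} = tr L_{bx} = λ(b x u) = 0` for all `b`. As `L_g` is right multiplication
    -- by `g` in the opposite algebra, the right ideal `x A` has to be treated as a left ideal there.
    let e := MulOpposite.opLinearEquiv k (M := A)
    have : FiniteDimensional k Aᵐᵒᵖ := Module.Finite.equiv e
    obtain ⟨g, hg, hg0⟩ := exists_mem_trace_mulRight_ne_zero (k := k) (A := Aᵐᵒᵖ) p
      (e.finrank_eq ▸ hp) (I := Ideal.span {MulOpposite.op x})
      (by rwa [Ne, Ideal.span_singleton_eq_bot, MulOpposite.op_eq_zero_iff])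
    obtain ⟨b, rfl⟩ := Ideal.mem_span_singleton'.mp hg
    apply hg0
    have h : LinearMap.mulRight k (b * MulOpposite.op x) =
        e.conj (LinearMap.mulLeft k (x * b.unop)) := by
      ext y
      simp [e, LinearEquiv.conj_apply, mul_assoc]
    rw [h, LinearMap.trace_conj', LinearMap.mulLeft_mul, LinearMap.trace_comp_comm',
      ← LinearMap.mulLeft_mul, hu, mul_assoc, hx, mul_zero, map_zero]
  -- `v * u = 1`, and one-sided inverses are two-sided in a Noetherian ring.
  obtain ⟨v, hv⟩ := LinearMap.injective_iff_surjective.mp hinj 1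
  have : IsNoetherianRing A := inferInstance
  exact ⟨⟨u, v, mul_eq_one_symm hv, hv⟩, rfl⟩

end SemisimpleAlgebra

end HopfFS

theorem mainTheorem9 {k H : Type*} [Field k] [IsAlgClosed k] [Ring H] [HopfAlgebra k H]
    [FiniteDimensional k H] [IsSemisimpleRing H]
    (p : ℕ) [CharP k p] (hp : p = 0 ∨ Module.finrank k H < p ^ 2)
    (Λ : H) (hΛ : HopfFS.IsLeftIntegral k Λ)
    (lam : H →ₗ[k] k) (hlam : HopfFS.IsRightDualIntegral lam) (hnorm : lam Λ = 1)
    {V : Type*} [AddCommGroup V] [Module k V] [Module H V] [IsScalarTower k H V]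
    [IsSimpleModule H V]
    (e : H) (he : HopfFS.IsCentralPrimitiveIdempotent e) (heV : ∀ v : V, e • v = v) :
    IsUnit (HopfFS.bfu k Λ) ∧ (Module.finrank k V : k) ≠ 0 ∧
      ∀ n : ℤ, HopfFS.indicator k V Λ n =
        HopfFS.character k V (HopfFS.sweedlerPower k H n Λ) * lam e /
          (Module.finrank k V : k) ^ 2 := by
  have htr := HopfFS.trace_mulLeft_eq_integral hΛ hlam hnorm
  have hu : IsUnit (HopfFS.bfu k Λ) := HopfFS.isUnit_of_trace_mulLeft p hp lam _ htr
  have hd : (Module.finrank k V : k) ≠ 0 := HopfFS.finrank_cast_ne_zero H V p hp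
  refine ⟨hu, hd, fun n => ?_⟩
  have : FiniteDimensional k V := Module.Finite.trans H V
  have hS := (HopfFS.antipode_bijective hΛ hlam hnorm).2
  have hcomm := HopfFS.commute_sweedlerPower hΛ
    (HopfFS.isRightIntegral_of_isLeftIntegral hS hΛ) hS n
  set z := HopfFS.sweedlerPower k H n Λ with hz
  -- Schur's lemma for the central element `z`.
  obtain ⟨c, hc⟩ : ∃ c : k, ∀ v : V, z • v = c • v := by
    let F : Module.End H V :=
      { toFun := fun v => z • v
        map_add' := smul_add z
        map_smul' := fun a v => by
          rw [RingHom.id_apply, ← mul_smul, ← mul_smul, (hcomm a).eq] }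
    obtain ⟨c, hc⟩ :=
      (IsSimpleModule.algebraMap_end_bijective_of_isAlgClosed (A := H) (V := V) k).2 F
    exact ⟨c, fun v => congr($hc v).symm⟩
  have hzc : Algebra.lsmul k k V z = c • (1 : Module.End k V) := LinearMap.ext hc
  -- `λ(e) = λ(e 𝐮⁻¹ 𝐮)` is the trace of left multiplication by `e 𝐮⁻¹`.
  have hlam_e : lam e = Module.finrank k V *
      HopfFS.character k V (Ring.inverse (HopfFS.bfu k Λ)) := by
    rw [HopfFS.character, ← HopfFS.trace_mulLeft_mul_idempotent he heV, htr, mul_assoc,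
      Ring.inverse_mul_cancel _ hu, mul_one]
  have hχz : HopfFS.character k V z = c * Module.finrank k V := by
    rw [HopfFS.character, hzc, map_smul, LinearMap.trace_one, smul_eq_mul]
  have hν : HopfFS.indicator k V Λ n =
      c * HopfFS.character k V (Ring.inverse (HopfFS.bfu k Λ)) := by
    rw [HopfFS.indicator, HopfFS.character, map_mul, ← hz, hzc, mul_smul_comm, mul_one, map_smul,
      smul_eq_mul, HopfFS.character]
  rw [hν, hχz, hlam_e]
  field_simp
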